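/- Let $\mathbb{D}$ be the open unit disk in $\mathbb{C}$, and let $\mathcal{B}$ be the Bloch space, i.e. the space of all analytic functions $f$ on $\mathbb{D}$ with $\|f\|_{\beta}=\sup_{z\in\mathbb{D}}(1-|z|^2)|f'(z)|<\infty$, normed by $\|f\|_{\mathcal{B}}=|f(0)|+\|f\|_{\beta}$. For an analytic self-map $\varphi$ of $\mathbb{D}$ let $C_\varphi f=f\circ\varphi$ be the induced composition operator on $\mathcal{B}$. **Theorem 3.** Let $k$ be a positive integer, let $\varphi_1,\dots,\varphi_k$ be analytic self-maps of $\mathbb{D}$ and let $\lambda_1,\dots,\lambda_k$ be nonzero complex scalars. Suppose that $\sum_{i\in J}\lambda_i\neq 0$ for every nonempty proper subset $J$ of $\{1,\dots,k\}$, and that at least one of the operators $C_{\varphi_1},\dots,C_{\varphi_k}$ is not compact on $\mathcal{B}$. Then the operator $\sum_{i=1}^k\lambda_iC_{\varphi_i}$ is compact on $\mathcal{B}$ if and only if the following two conditions are satisfied: (i) $\sum_{i=1}^k\lambda_i=0$; (ii) $C_{\varphi_i}-C_{\varphi_j}$ is compact on $\mathcal{B}$ for all $i,j\in\{1,\dots,k\}$.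 -/

import Mathlib

open Complex Metric
open scoped UnitDisc ComplexConjugate

noncomputable section

/-- Extension by zero to `ℂ` of a function on the open unit disc `𝔻`. -/
def discExtend (f : 𝔻 → ℂ) (z : ℂ) : ℂ :=
  if h : ‖z‖ < 1 then f (UnitDisc.mk z h) else 0

/-- `f ∈ H(𝔻)`: the function `f` is analytic in the open unit disc. (The values of the extension
outside the open disc are irrelevant for differentiability at points of the disc.) -/
def AnalyticOnDisc (f : 𝔻 → ℂ) : Prop :=
  DifferentiableOn ℂ (discExtend f) (ball 0 1)

/-- The complex derivative `f'(z)` at a point of the disc. -/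
def discDeriv (f : 𝔻 → ℂ) (z : 𝔻) : ℂ := deriv (discExtend f) z

/-- Analytic self-maps of the unit disc. -/
structure AnalyticSelfMap where
  /-- the underlying map -/
  toFun : 𝔻 → 𝔻
  analytic : AnalyticOnDisc (fun z => (toFun z : ℂ))

theorem discExtend_coe (f : 𝔻 → ℂ) (z : 𝔻) : discExtend f z = f z := by
  simp [discExtend, z.norm_lt_one]

theorem discExtend_add (f g : 𝔻 → ℂ) : discExtend (f + g) = discExtend f + discExtend g := by
  funext z; by_cases h : ‖z‖ < 1 <;> simp [discExtend, h]

theorem discExtend_smul (c : ℂ) (f : 𝔻 → ℂ) : discExtend (c • f) = c • discExtend f := by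
  funext z; by_cases h : ‖z‖ < 1 <;> simp [discExtend, h]

theorem discExtend_zero : discExtend 0 = 0 := by
  funext z; by_cases h : ‖z‖ < 1 <;> simp [discExtend, h]

theorem coe_mem_ball (z : 𝔻) : (z : ℂ) ∈ ball (0 : ℂ) 1 := by
  simpa using z.norm_lt_one

theorem AnalyticOnDisc.differentiableAt {f : 𝔻 → ℂ} (hf : AnalyticOnDisc f) (z : 𝔻) :
    DifferentiableAt ℂ (discExtend f) z :=
  DifferentiableOn.differentiableAt hf (isOpen_ball.mem_nhds (coe_mem_ball z))

theorem discDeriv_add {f g : 𝔻 → ℂ} (hf : AnalyticOnDisc f) (hg : AnalyticOnDisc g) (z : 𝔻) :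
    discDeriv (f + g) z = discDeriv f z + discDeriv g z := by
  rw [discDeriv, discExtend_add]
  exact deriv_add (hf.differentiableAt z) (hg.differentiableAt z)

theorem discDeriv_smul (c : ℂ) {f : 𝔻 → ℂ} (hf : AnalyticOnDisc f) (z : 𝔻) :
    discDeriv (c • f) z = c * discDeriv f z := by
  rw [discDeriv, discExtend_smul]
  exact deriv_const_smul c (hf.differentiableAt z)

/-- The weighted derivative `(1 - |z|²) |f'(z)|`. -/
def blochWeight (f : 𝔻 → ℂ) (z : 𝔻) : ℝ := (1 - ‖(z : ℂ)‖ ^ 2) * ‖discDeriv f z‖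

theorem one_sub_sq_pos (z : 𝔻) : 0 < 1 - ‖(z : ℂ)‖ ^ 2 := by
  have := z.sq_norm_lt_one; linarith

theorem blochWeight_nonneg (f : 𝔻 → ℂ) (z : 𝔻) : 0 ≤ blochWeight f z :=
  mul_nonneg (one_sub_sq_pos z).le (norm_nonneg _)

theorem blochWeight_add {f g : 𝔻 → ℂ} (hf : AnalyticOnDisc f) (hg : AnalyticOnDisc g) (z : 𝔻) :
    blochWeight (f + g) z ≤ blochWeight f z + blochWeight g z := by
  rw [blochWeight, discDeriv_add hf hg, blochWeight, blochWeight, ← mul_add]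
  exact mul_le_mul_of_nonneg_left (norm_add_le _ _) (one_sub_sq_pos z).le

theorem blochWeight_smul (c : ℂ) {f : 𝔻 → ℂ} (hf : AnalyticOnDisc f) (z : 𝔻) :
    blochWeight (c • f) z = ‖c‖ * blochWeight f z := by
  rw [blochWeight, discDeriv_smul c hf, blochWeight, norm_mul]; ring

/-- The Bloch functions, as a linear subspace of the functions on `𝔻`: analytic functions `f` with
`sup_{z ∈ 𝔻} (1 - |z|²) |f'(z)| < ∞`. -/
def blochSubmodule : Submodule ℂ (𝔻 → ℂ) where
  carrier := {f | AnalyticOnDisc f ∧ BddAbove (Set.range (blochWeight f))}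
  add_mem' := by
    rintro f g ⟨hf, A, hA⟩ ⟨hg, B, hB⟩
    refine ⟨?_, A + B, ?_⟩
    · rw [AnalyticOnDisc, discExtend_add]; exact DifferentiableOn.add hf hg
    · rintro _ ⟨z, rfl⟩
      exact (blochWeight_add hf hg z).trans (add_le_add (hA ⟨z, rfl⟩) (hB ⟨z, rfl⟩))
  zero_mem' := by
    refine ⟨?_, 0, ?_⟩
    · rw [AnalyticOnDisc, discExtend_zero]; exact differentiableOn_const 0
    · rintro _ ⟨z, rfl⟩
      simp [blochWeight, discDeriv, discExtend_zero]
  smul_mem' := by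
    rintro c f ⟨hf, A, hA⟩
    refine ⟨?_, ‖c‖ * A, ?_⟩
    · rw [AnalyticOnDisc, discExtend_smul]; exact DifferentiableOn.const_smul hf c
    · rintro _ ⟨z, rfl⟩
      rw [blochWeight_smul c hf]
      exact mul_le_mul_of_nonneg_left (hA ⟨z, rfl⟩) (norm_nonneg c)

/-- The Bloch space `𝓑`. It is a separate type, so that its only topology is that of the Bloch norm
and not the topology of pointwise convergence. -/
def Bloch : Type := blochSubmodule

namespace Bloch

instance : AddCommGroup Bloch := inferInstanceAs (AddCommGroup blochSubmodule)

instance : Module ℂ Bloch := inferInstanceAs (Module ℂ blochSubmodule)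

instance : CoeFun Bloch (fun _ => 𝔻 → ℂ) := ⟨fun f => Subtype.val f⟩

theorem coe_add (f g : Bloch) : (⇑(f + g) : 𝔻 → ℂ) = ⇑f + ⇑g := rfl

theorem coe_smul (c : ℂ) (f : Bloch) : (⇑(c • f) : 𝔻 → ℂ) = c • ⇑f := rfl

theorem coe_zero : (⇑(0 : Bloch) : 𝔻 → ℂ) = 0 := rfl

theorem analytic (f : Bloch) : AnalyticOnDisc f := (Subtype.prop f).1

theorem bddAbove (f : Bloch) : BddAbove (Set.range (blochWeight f)) := (Subtype.prop f).2

/-- The seminorm `‖f‖_β = sup_{z ∈ 𝔻} (1 - |z|²) |f'(z)|`. -/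
def betaSeminorm (f : Bloch) : ℝ := ⨆ z : 𝔻, blochWeight f z

/-- The Bloch norm `‖f‖ = |f(0)| + ‖f‖_β`. -/
instance : Norm Bloch := ⟨fun f => ‖f 0‖ + betaSeminorm f⟩

theorem norm_def (f : Bloch) : ‖f‖ = ‖f 0‖ + ⨆ z : 𝔻, blochWeight f z := rfl

theorem betaSeminorm_nonneg (f : Bloch) : 0 ≤ betaSeminorm f :=
  Real.iSup_nonneg (blochWeight_nonneg f)

theorem blochWeight_le (f : Bloch) (z : 𝔻) : blochWeight f z ≤ betaSeminorm f :=
  le_ciSup f.bddAbove z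

theorem normedSpaceCore : NormedSpace.Core ℂ Bloch where
  norm_nonneg f := add_nonneg (norm_nonneg _) (betaSeminorm_nonneg f)
  norm_smul c f := by
    simp only [norm_def, coe_smul, Pi.smul_apply, norm_smul, blochWeight_smul c f.analytic]
    rw [← Real.mul_iSup_of_nonneg (norm_nonneg c), mul_add]
  norm_triangle f g := by
    have h : betaSeminorm (f + g) ≤ betaSeminorm f + betaSeminorm g :=
      ciSup_le fun z => (blochWeight_add f.analytic g.analytic z).trans
        (add_le_add (f.blochWeight_le z) (g.blochWeight_le z))
    have h0 : ‖(f + g) 0‖ ≤ ‖f 0‖ + ‖g 0‖ := norm_add_le _ _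
    change ‖(f + g) 0‖ + betaSeminorm (f + g) ≤
      (‖f 0‖ + betaSeminorm f) + (‖g 0‖ + betaSeminorm g)
    linarith
  norm_eq_zero_iff f := by
    constructor
    · intro h
      change ‖f 0‖ + betaSeminorm f = 0 at h
      have h1 := f.betaSeminorm_nonneg
      have h2 := norm_nonneg (f 0)
      have hβ : betaSeminorm f = 0 := by linarith
      have h0 : f 0 = 0 := norm_eq_zero.1 (by linarith)
      have hd : ∀ z : 𝔻, discDeriv f z = 0 := by
        intro z
        have hz := f.blochWeight_le z
        rw [hβ, blochWeight] at hz
        have hp := one_sub_sq_pos z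
        have hn := norm_nonneg (discDeriv f z)
        exact norm_eq_zero.1 (by nlinarith)
      apply Subtype.ext
      funext z
      have hc := isOpen_ball.is_const_of_deriv_eq_zero
        (convex_ball (0 : ℂ) 1).isPreconnected f.analytic
        (fun w hw => hd (UnitDisc.mk w (by simpa using hw)))
        (coe_mem_ball z) (coe_mem_ball 0)
      rw [discExtend_coe, discExtend_coe, h0] at hc
      exact hc
    · rintro rfl
      simp [norm_def, coe_zero, blochWeight, discDeriv, discExtend_zero]

instance : NormedAddCommGroup Bloch := NormedAddCommGroup.ofCore normedSpaceCore

instance : NormedSpace ℂ Bloch := NormedSpace.ofCore normedSpaceCore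

end Bloch

theorem one_add_conj_mul_ne_zero (a w : 𝔻) : 1 + conj (a : ℂ) * w ≠ 0 := by
  intro h
  have h1 : ‖conj (a : ℂ) * w‖ = 1 := by
    rw [← neg_eq_of_add_eq_zero_right h]; simp
  rw [norm_mul, RCLike.norm_conj] at h1
  nlinarith [a.norm_lt_one, w.norm_lt_one, norm_nonneg (a : ℂ), norm_nonneg (w : ℂ)]

theorem norm_moebius_lt_one (a w : 𝔻) : ‖((w : ℂ) + a) / (1 + conj (a : ℂ) * w)‖ < 1 := by
  rw [norm_div, div_lt_one (norm_pos_iff.2 (one_add_conj_mul_ne_zero a w)),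
    ← sq_lt_sq₀ (norm_nonneg _) (norm_nonneg _)]
  have ha := a.normSq_lt_one
  have hw := w.normSq_lt_one
  rw [← Complex.normSq_eq_norm_sq, ← Complex.normSq_eq_norm_sq]
  simp only [Complex.normSq_apply, Complex.add_re, Complex.add_im, Complex.mul_re, Complex.mul_im,
    Complex.conj_re, Complex.conj_im, Complex.one_re, Complex.one_im] at ha hw ⊢
  nlinarith [mul_pos (sub_pos.2 ha) (sub_pos.2 hw)]

theorem hasDerivAt_moebius (a w : 𝔻) :
    HasDerivAt (fun w : ℂ => (w + a) / (1 + conj (a : ℂ) * w))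
      ((1 - conj (a : ℂ) * a) / (1 + conj (a : ℂ) * w) ^ 2) w := by
  have h1 : HasDerivAt (fun w : ℂ => w + a) 1 (w : ℂ) := (hasDerivAt_id _).add_const _
  have h2 : HasDerivAt (fun w : ℂ => 1 + conj (a : ℂ) * w) (conj (a : ℂ)) (w : ℂ) := by
    simpa using ((hasDerivAt_id (w : ℂ)).const_mul (conj (a : ℂ))).const_add 1
  have h3 := h1.fun_div h2 (one_add_conj_mul_ne_zero a w)
  have e : 1 * (1 + conj (a : ℂ) * w) - (w + a) * conj (a : ℂ) = 1 - conj (a : ℂ) * a := by ring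
  rwa [e] at h3

/-- The Schwarz–Pick inequality; it shows that composition operators map `𝓑` into itself. -/
theorem schwarzPick (φ : AnalyticSelfMap) (z : 𝔻) :
    (1 - ‖(z : ℂ)‖ ^ 2) * ‖discDeriv (fun w => (φ.toFun w : ℂ)) z‖ ≤
      1 - ‖(φ.toFun z : ℂ)‖ ^ 2 := by
  set F := discExtend (fun w => (φ.toFun w : ℂ)) with hF
  set b : 𝔻 := -φ.toFun z with hb
  let m : 𝔻 → ℂ → ℂ := fun a w => (w + a) / (1 + conj (a : ℂ) * w)
  have hm : ∀ (a : 𝔻) (w : ℂ) (hw : w ∈ ball (0 : ℂ) 1), ∃ u : 𝔻, m a w = u := by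
    intro a w hw
    exact ⟨UnitDisc.mk _ (norm_moebius_lt_one a (UnitDisc.mk w (by simpa using hw))), rfl⟩
  have hFu : ∀ u : 𝔻, F u = φ.toFun u := fun u => discExtend_coe _ u
  have hmd : ∀ (a u : 𝔻), DifferentiableAt ℂ (m a) u :=
    fun a u => (hasDerivAt_moebius a u).differentiableAt
  have hmz : m z 0 = z := by simp [m]
  have hzero : m b (F (m z 0)) = 0 := by
    rw [hmz, hFu]; simp [m, hb]
  have hd : DifferentiableOn ℂ (fun w => m b (F (m z w))) (ball 0 1) := by
    intro w hw
    obtain ⟨u, hu⟩ := hm z w hw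
    have e1 : DifferentiableAt ℂ (m z) w := hmd z (UnitDisc.mk w (by simpa using hw))
    have e2 : DifferentiableAt ℂ F (m z w) := by
      rw [hu]; exact φ.analytic.differentiableAt u
    have e3 : DifferentiableAt ℂ (m b) (F (m z w)) := by
      rw [hu, hFu]; exact hmd b _
    have e4 : DifferentiableAt ℂ (fun w => F (m z w)) w := e2.comp w e1
    exact (e3.comp w e4).differentiableWithinAt
  have hmaps : Set.MapsTo (fun w => m b (F (m z w))) (ball 0 1)
      (closedBall (m b (F (m z 0))) 1) := by
    intro w hw
    obtain ⟨u, hu⟩ := hm z w hw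
    rw [hzero, mem_closedBall_zero_iff]
    simp only [hu, hFu]
    exact (norm_moebius_lt_one b (φ.toFun u)).le
  have key := Complex.norm_deriv_le_one_of_mapsTo_ball hd hmaps one_pos
  have d1 : HasDerivAt (m z) (1 - conj (z : ℂ) * z) 0 := by
    simpa using hasDerivAt_moebius z 0
  have d2 : HasDerivAt F (deriv F z) (m z 0) := by
    rw [hmz]; exact (φ.analytic.differentiableAt z).hasDerivAt
  have d3 := hasDerivAt_moebius b (φ.toFun z)
  have d3' : HasDerivAt (m b) ((1 - conj (b : ℂ) * b) / (1 + conj (b : ℂ) * φ.toFun z) ^ 2)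
      (F (m z 0)) := by
    rw [hmz, hFu]; exact d3
  have d := HasDerivAt.comp (0 : ℂ) d3' (HasDerivAt.comp (0 : ℂ) d2 d1)
  have hder : deriv (fun w => m b (F (m z w))) 0 = _ := d.deriv
  rw [hder] at key
  have nz : ∀ a : 𝔻, ‖1 - conj (a : ℂ) * a‖ = 1 - ‖(a : ℂ)‖ ^ 2 := by
    intro a
    rw [Complex.conj_mul']
    have : (1 - (‖(a : ℂ)‖ : ℂ) ^ 2) = ((1 - ‖(a : ℂ)‖ ^ 2 : ℝ) : ℂ) := by push_cast; rfl
    rw [this, Complex.norm_real, Real.norm_of_nonneg (one_sub_sq_pos a).le]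
  have hb2 : 1 + conj (b : ℂ) * (φ.toFun z : ℂ) =
      1 - conj (φ.toFun z : ℂ) * (φ.toFun z : ℂ) := by
    rw [hb, UnitDisc.coe_neg, map_neg]; ring
  have hb1 : 1 - conj (b : ℂ) * (b : ℂ) = 1 - conj (φ.toFun z : ℂ) * (φ.toFun z : ℂ) := by
    rw [hb, UnitDisc.coe_neg, map_neg]; ring
  rw [hb1, hb2, norm_mul, norm_mul, norm_div, norm_pow, nz, nz] at key
  have hp := one_sub_sq_pos (φ.toFun z)
  change (1 - ‖(z : ℂ)‖ ^ 2) * ‖deriv F z‖ ≤ _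
  have e : (1 - ‖(φ.toFun z : ℂ)‖ ^ 2) / (1 - ‖(φ.toFun z : ℂ)‖ ^ 2) ^ 2 *
      (‖deriv F z‖ * (1 - ‖(z : ℂ)‖ ^ 2)) =
      ((1 - ‖(z : ℂ)‖ ^ 2) * ‖deriv F z‖) / (1 - ‖(φ.toFun z : ℂ)‖ ^ 2) := by
    field_simp
  rw [e, div_le_one hp] at key
  exact key

theorem discExtend_comp (f : 𝔻 → ℂ) (φ : AnalyticSelfMap) {z : ℂ} (hz : z ∈ ball (0 : ℂ) 1) :
    discExtend (f ∘ φ.toFun) z = discExtend f (discExtend (fun w => (φ.toFun w : ℂ)) z) := by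
  obtain ⟨u, rfl⟩ : ∃ u : 𝔻, (u : ℂ) = z := ⟨UnitDisc.mk z (by simpa using hz), rfl⟩
  simp only [discExtend_coe, Function.comp_apply]

theorem hasDerivAt_discExtend_comp {f : 𝔻 → ℂ} (hf : AnalyticOnDisc f) (φ : AnalyticSelfMap)
    (z : 𝔻) : HasDerivAt (discExtend (f ∘ φ.toFun))
      (discDeriv f (φ.toFun z) * discDeriv (fun w => (φ.toFun w : ℂ)) z) z := by
  have h1 : HasDerivAt (discExtend f) (discDeriv f (φ.toFun z))
      (discExtend (fun w => (φ.toFun w : ℂ)) z) := by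
    rw [discExtend_coe]; exact (hf.differentiableAt (φ.toFun z)).hasDerivAt
  have h2 := h1.comp (z : ℂ) (φ.analytic.differentiableAt z).hasDerivAt
  refine h2.congr_of_eventuallyEq ?_
  filter_upwards [isOpen_ball.mem_nhds (coe_mem_ball z)] with w hw
  exact discExtend_comp f φ hw

theorem comp_mem_blochSubmodule (φ : AnalyticSelfMap) (f : Bloch) :
    ((f : 𝔻 → ℂ) ∘ φ.toFun) ∈ blochSubmodule := by
  refine ⟨fun z hz => ?_, f.betaSeminorm, ?_⟩
  · exact (hasDerivAt_discExtend_comp f.analytic φ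
      (UnitDisc.mk z (by simpa using hz))).differentiableAt.differentiableWithinAt
  · rintro _ ⟨z, rfl⟩
    rw [blochWeight, discDeriv, (hasDerivAt_discExtend_comp f.analytic φ z).deriv, norm_mul]
    calc _ = ((1 - ‖(z : ℂ)‖ ^ 2) * ‖discDeriv (fun w => (φ.toFun w : ℂ)) z‖) *
          ‖discDeriv f (φ.toFun z)‖ := by ring
      _ ≤ blochWeight f (φ.toFun z) :=
          mul_le_mul_of_nonneg_right (schwarzPick φ z) (norm_nonneg _)
      _ ≤ f.betaSeminorm := f.blochWeight_le _

/-- The composition operator `C_φ f = f ∘ φ` on the Bloch space. -/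
def compositionOperator (φ : AnalyticSelfMap) : Bloch →ₗ[ℂ] Bloch where
  toFun f := ⟨(f : 𝔻 → ℂ) ∘ φ.toFun, comp_mem_blochSubmodule φ f⟩
  map_add' _ _ := rfl
  map_smul' _ _ := rfl

theorem compositionOperator_apply (φ : AnalyticSelfMap) (f : Bloch) (z : 𝔻) :
    compositionOperator φ f z = f (φ.toFun z) := rfl

end

/-! Write σ_a for `moebius a`. The Bloch seminorm is invariant under disc automorphisms, so
behaviour along points z can be read at the origin. Given z with |φ_j(z)| → 1 and b = φ_j(z),
consider the recentred maps σ_{-b} ∘ φ_i ∘ σ_z. Along an ultrafilter they have pointwise limits Ψ_i,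
differentiable at 0.

Suppose the combination T is compact. The functions p ∘ σ_{-b} - p(-b), p a polynomial, are bounded
and pointwise null, so T sends them to norm null families. Reading this at σ_z(ζ) and σ_z(0) gives ∑
c_i (p(Ψ_i(ζ)) - p(Ψ_i(0))) = 0 (`sum_mul_eval_sub_eval_eq_zero`). If Ψ_j'(0) ≠ 0, then for small ζ
≠ 0 the value Ψ_j(ζ) avoids every Ψ_i(0), and interpolation isolates the indices with Ψ_i(ζ) =
Ψ_j(ζ): their coefficients sum to 0. The subsum hypothesis makes this set everything, so ∑ c_i = 0
and all Ψ_i agree near 0 (`sum_eq_zero_and_eventually_tendsto`).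

Noncompactness of one C_{φ_j} supplies such a nondegenerate family, whence (i). For (ii), test
C_{φ_i} - C_{φ_j} on bounded pointwise null families: where some symbol is nondegenerate the common
limit cancels the two terms, and elsewhere each term is null by itself. Conversely, ∑ c_i = 0 turns
T into a combination of differences. -/

noncomputable section

open Filter Topology

/-! ### Limits of holomorphic functions along ultrafilters -/

section Limits

theorem norm_deriv_le_div_of_norm_sub_le {F : ℂ → ℂ} {w : ℂ} {r M : ℝ} (hr : 0 < r)
    (hF : DifferentiableOn ℂ F (ball w r)) (hM : ∀ u ∈ ball w r, ‖F u - F w‖ ≤ M) :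
    ‖deriv F w‖ ≤ M / r := by
  rw [← dslope_same]
  exact norm_dslope_le_div_of_mapsTo_ball hF
    (fun u hu => mem_closedBall_iff_norm.2 (hM u hu)) (mem_ball_self hr)

/-- First order Taylor estimate for a holomorphic function of bounded oscillation on a disc. -/
theorem norm_sub_sub_mul_deriv_le {F : ℂ → ℂ} {w u : ℂ} {r M : ℝ}
    (hF : DifferentiableOn ℂ F (ball w r)) (hM : ∀ u ∈ ball w r, ‖F u - F w‖ ≤ M)
    (hu : u ∈ ball w r) :
    ‖F u - F w - (u - w) * deriv F w‖ ≤ 2 * (M / r) / r * ‖u - w‖ ^ 2 := by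
  have hr : 0 < r := pos_of_mem_ball hu
  have h1 : ∀ v ∈ ball w r, ‖dslope F w v‖ ≤ M / r := fun v hv =>
    norm_dslope_le_div_of_mapsTo_ball hF (fun u hu => mem_closedBall_iff_norm.2 (hM u hu)) hv
  have h2 : DifferentiableOn ℂ (dslope F w) (ball w r) :=
    (differentiableOn_dslope (ball_mem_nhds w hr)).2 hF
  -- The first divided difference is bounded by M / r, so it oscillates by at most twice that, and
  -- the Schwarz estimate applies to it again.
  have h3 : ‖dslope (dslope F w) w u‖ ≤ 2 * (M / r) / r := by
    refine norm_dslope_le_div_of_mapsTo_ball h2 (fun v hv => mem_closedBall_iff_norm.2 ?_) hu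
    have := norm_sub_le (dslope F w v) (dslope F w w)
    linarith [h1 v hv, h1 w (mem_ball_self hr)]
  have e1 := sub_smul_dslope F w u
  have e2 := sub_smul_dslope (dslope F w) w u
  rw [dslope_same] at e2
  simp only [smul_eq_mul] at e1 e2
  have e : F u - F w - (u - w) * deriv F w = (u - w) ^ 2 * dslope (dslope F w) w u := by
    rw [← e1, ← mul_sub, ← e2]; ring
  rw [e, norm_mul, norm_pow, mul_comm]
  gcongr

/-- A pointwise limit of holomorphic functions of uniformly bounded oscillation is differentiable
at the centre, with derivative the limit of the derivatives. -/
theorem hasDerivAt_of_tendsto_of_norm_sub_le {X : Type*} {l : Filter X} [l.NeBot]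
    {F : X → ℂ → ℂ} {ψ : ℂ → ℂ} {w a : ℂ} {r M : ℝ} (hr : 0 < r)
    (hF : ∀ x, DifferentiableOn ℂ (F x) (ball w r))
    (hM : ∀ x, ∀ u ∈ ball w r, ‖F x u - F x w‖ ≤ M)
    (hψ : ∀ u ∈ ball w r, Tendsto (fun x => F x u - F x w) l (𝓝 (ψ u - ψ w)))
    (ha : Tendsto (fun x => deriv (F x) w) l (𝓝 a)) : HasDerivAt ψ a w := by
  rw [hasDerivAt_iff_isLittleO]
  -- The quadratic Taylor bound is uniform in x, so it survives the limit; holomorphy of ψ is not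
  -- needed.
  have h : (fun u => ψ u - ψ w - (u - w) • a) =O[𝓝 w] fun u => ‖u - w‖ ^ 2 := by
    refine Asymptotics.IsBigO.of_bound (2 * (M / r) / r) ?_
    filter_upwards [ball_mem_nhds w hr] with u hu
    rw [norm_pow, norm_norm]
    refine le_of_tendsto ((hψ u hu).sub (ha.const_mul (u - w))).norm (Eventually.of_forall ?_)
    intro x
    exact norm_sub_sub_mul_deriv_le (hF x) (hM x) hu
  refine h.trans_isLittleO ?_
  have h2 : (fun u : ℂ => ‖u‖ ^ 2) =o[𝓝 0] fun u => u := by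
    rw [← Asymptotics.isLittleO_norm_right]
    simpa using Asymptotics.isLittleO_norm_pow_norm_pow (E' := ℂ) one_lt_two
  have h3 : Tendsto (fun u : ℂ => u - w) (𝓝 w) (𝓝 0) := by
    have : Continuous fun u : ℂ => u - w := by fun_prop
    simpa using this.tendsto w
  exact h2.comp_tendsto h3

/-- Ultrafilters replace subsequences: all the pointwise limits needed exist at once along the same
l, with no diagonal argument. -/
theorem exists_tendsto_of_norm_le {X : Type*} (l : Ultrafilter X) {f : X → ℂ} {M : ℝ}
    (hf : ∀ x, ‖f x‖ ≤ M) : ∃ a, ‖a‖ ≤ M ∧ Tendsto f l (𝓝 a) := by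
  obtain ⟨a, ha, h⟩ := (isCompact_closedBall (0 : ℂ) M).ultrafilter_le_nhds (l.map f)
    (by
      rw [le_principal_iff, Ultrafilter.mem_coe, Ultrafilter.mem_map]
      exact univ_mem' fun x => by simpa using hf x)
  exact ⟨a, by simpa using ha, h⟩

/-- The derivatives are bounded, so they have an ultralimit, which must be the derivative of the
zero function. -/
theorem tendsto_deriv_zero_of_tendsto_sub_zero {X : Type*} {l : Ultrafilter X}
    {F : X → ℂ → ℂ} {w : ℂ} {r M : ℝ} (hr : 0 < r)
    (hF : ∀ x, DifferentiableOn ℂ (F x) (ball w r))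
    (hM : ∀ x, ∀ u ∈ ball w r, ‖F x u - F x w‖ ≤ M)
    (hψ : ∀ u ∈ ball w r, Tendsto (fun x => F x u - F x w) l (𝓝 0)) :
    Tendsto (fun x => deriv (F x) w) l (𝓝 0) := by
  obtain ⟨a, -, ha⟩ := exists_tendsto_of_norm_le l
    fun x => norm_deriv_le_div_of_norm_sub_le hr (hF x) (hM x)
  have h := hasDerivAt_of_tendsto_of_norm_sub_le (ψ := fun _ => 0) hr hF hM (by simpa using hψ) ha
  rwa [h.unique (hasDerivAt_const w 0)] at ha

end Limits

/-! ### Growth and oscillation of Bloch functions -/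

section Bloch

/-- The mean value inequality on the disc of radius r, where |f'| ≤ B / (1 - r²). It gives
equicontinuity of seminorm-bounded families on compact subsets of the disc. -/
theorem norm_sub_le_of_blochWeight_le {f : 𝔻 → ℂ} (hf : AnalyticOnDisc f) {B r : ℝ}
    (hB : ∀ z, blochWeight f z ≤ B) (hr : r < 1) {u v : ℂ} (hu : ‖u‖ ≤ r) (hv : ‖v‖ ≤ r) :
    ‖discExtend f u - discExtend f v‖ ≤ B / (1 - r ^ 2) * ‖u - v‖ := by
  have hr0 : 0 ≤ r := (norm_nonneg u).trans hu
  refine Convex.norm_image_sub_le_of_norm_deriv_le (s := closedBall 0 r) ?_ ?_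
    (convex_closedBall 0 r) (by simpa using hv) (by simpa using hu)
  · intro x hx
    have hx : ‖x‖ ≤ r := by simpa using hx
    exact hf.differentiableAt (UnitDisc.mk x (hx.trans_lt hr))
  · intro x hx
    have hx : ‖x‖ ≤ r := by simpa using hx
    have h := hB (UnitDisc.mk x (hx.trans_lt hr))
    rw [blochWeight, discDeriv, UnitDisc.coe_mk] at h
    have hr2 : 0 < 1 - r ^ 2 := by nlinarith
    rw [le_div_iff₀ hr2, mul_comm]
    refine le_trans ?_ h
    gcongr

theorem Bloch.betaSeminorm_le_norm (f : Bloch) : f.betaSeminorm ≤ ‖f‖ :=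
  le_add_of_nonneg_left (norm_nonneg (f 0))

theorem Bloch.norm_apply_zero_le (f : Bloch) : ‖f 0‖ ≤ ‖f‖ :=
  le_add_of_nonneg_right f.betaSeminorm_nonneg

theorem Bloch.coe_sub (f g : Bloch) : (⇑(f - g) : 𝔻 → ℂ) = ⇑f - ⇑g := rfl

theorem Bloch.norm_apply_sub_apply_zero_le (f : Bloch) (w : 𝔻) :
    ‖f w - f 0‖ ≤ f.betaSeminorm / (1 - ‖(w : ℂ)‖ ^ 2) := by
  have h := norm_sub_le_of_blochWeight_le f.analytic f.blochWeight_le w.norm_lt_one le_rfl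
    (by simp : ‖((0 : 𝔻) : ℂ)‖ ≤ _)
  rw [discExtend_coe, discExtend_coe, UnitDisc.coe_zero, sub_zero] at h
  refine h.trans (mul_le_of_le_one_right ?_ w.norm_lt_one.le)
  exact div_nonneg f.betaSeminorm_nonneg (one_sub_sq_pos w).le

theorem Bloch.norm_apply_le (f : Bloch) (w : 𝔻) :
    ‖f w‖ ≤ (1 + 1 / (1 - ‖(w : ℂ)‖ ^ 2)) * ‖f‖ := by
  have h := f.norm_apply_sub_apply_zero_le w
  have h1 : f.betaSeminorm / (1 - ‖(w : ℂ)‖ ^ 2) ≤ ‖f‖ / (1 - ‖(w : ℂ)‖ ^ 2) :=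
    div_le_div_of_nonneg_right f.betaSeminorm_le_norm (one_sub_sq_pos w).le
  have h2 := norm_add_le (f w - f 0) (f 0)
  rw [sub_add_cancel] at h2
  have h3 := f.norm_apply_zero_le
  calc ‖f w‖ ≤ ‖f‖ + ‖f‖ / (1 - ‖(w : ℂ)‖ ^ 2) := by linarith
    _ = _ := by ring

theorem Bloch.norm_le_of_blochWeight_le {f : Bloch} {A : ℝ} (h : ∀ z, ‖f 0‖ + blochWeight f z ≤ A) :
    ‖f‖ ≤ A := by
  have : f.betaSeminorm ≤ A - ‖f 0‖ := ciSup_le fun z => by linarith [h z]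
  change ‖f 0‖ + f.betaSeminorm ≤ A
  linarith

end Bloch

/-! ### Disc automorphisms -/

namespace AnalyticSelfMap

/-- Composition of analytic self-maps. -/
def comp (φ ψ : AnalyticSelfMap) : AnalyticSelfMap where
  toFun := φ.toFun ∘ ψ.toFun
  analytic z hz := (hasDerivAt_discExtend_comp φ.analytic ψ
    (UnitDisc.mk z (by simpa using hz))).differentiableAt.differentiableWithinAt

theorem comp_apply (φ ψ : AnalyticSelfMap) (z : 𝔻) :
    (φ.comp ψ).toFun z = φ.toFun (ψ.toFun z) := rfl

/-- The disc automorphism `w ↦ (w + a) / (1 + conj a * w)`. -/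
def moebius (a : 𝔻) : AnalyticSelfMap where
  toFun w := UnitDisc.mk _ (norm_moebius_lt_one a w)
  analytic := by
    intro w hw
    refine DifferentiableAt.differentiableWithinAt
      ((hasDerivAt_moebius a (UnitDisc.mk w (by simpa using hw))).congr_of_eventuallyEq
        ?_).differentiableAt
    filter_upwards [isOpen_ball.mem_nhds hw] with u hu
    exact discExtend_coe _ (UnitDisc.mk u (by simpa using hu))

theorem coe_moebius (a w : 𝔻) :
    ((moebius a).toFun w : ℂ) = (w + a) / (1 + conj (a : ℂ) * w) := rfl

theorem moebius_zero (a : 𝔻) : (moebius a).toFun 0 = a := by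
  rw [← UnitDisc.coe_inj, coe_moebius]; simp

theorem moebius_neg_self (a : 𝔻) : (moebius (-a)).toFun a = 0 := by
  rw [← UnitDisc.coe_inj, coe_moebius]; simp

theorem one_sub_conj_mul_self_ne_zero (a : 𝔻) : 1 - conj (a : ℂ) * a ≠ 0 := by
  have := one_add_conj_mul_ne_zero (-a) a
  simpa [sub_eq_add_neg] using this

theorem moebius_moebius_neg (a w : 𝔻) : (moebius a).toFun ((moebius (-a)).toFun w) = w := by
  rw [← UnitDisc.coe_inj, coe_moebius, coe_moebius]
  have h1 := one_add_conj_mul_ne_zero (-a) w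
  have h2 := one_sub_conj_mul_self_ne_zero a
  simp only [UnitDisc.coe_neg, map_neg, neg_mul] at h1 ⊢
  rw [div_add' _ _ _ h1, mul_div_assoc', add_div' _ _ _ h1, div_div_div_cancel_right₀ h1]
  rw [div_eq_iff (by ring_nf; ring_nf at h2; exact h2)]
  ring

theorem discDeriv_moebius (a w : 𝔻) : discDeriv (fun u => ((moebius a).toFun u : ℂ)) w =
    (1 - conj (a : ℂ) * a) / (1 + conj (a : ℂ) * w) ^ 2 := by
  refine ((hasDerivAt_moebius a w).congr_of_eventuallyEq ?_).deriv
  filter_upwards [isOpen_ball.mem_nhds (coe_mem_ball w)] with u hu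
  exact discExtend_coe _ (UnitDisc.mk u (by simpa using hu))

theorem norm_discExtend_le (φ : AnalyticSelfMap) (u : ℂ) :
    ‖discExtend (fun w => (φ.toFun w : ℂ)) u‖ ≤ 1 := by
  rw [discExtend]
  split_ifs
  · exact (UnitDisc.norm_lt_one _).le
  · simp

end AnalyticSelfMap

open AnalyticSelfMap

/-! ### Möbius invariance and evaluation on the Bloch space -/

theorem discDeriv_comp {f : 𝔻 → ℂ} (hf : AnalyticOnDisc f) (φ : AnalyticSelfMap) (z : 𝔻) :
    discDeriv (f ∘ φ.toFun) z =
      discDeriv f (φ.toFun z) * discDeriv (fun w => (φ.toFun w : ℂ)) z :=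
  (hasDerivAt_discExtend_comp hf φ z).deriv

theorem blochWeight_eq_norm_discDeriv_comp_moebius {f : 𝔻 → ℂ} (hf : AnalyticOnDisc f) (z : 𝔻) :
    blochWeight f z = ‖discDeriv (f ∘ (moebius z).toFun) 0‖ := by
  have e : 1 - conj (z : ℂ) * z = ((1 - ‖(z : ℂ)‖ ^ 2 : ℝ) : ℂ) := by
    rw [Complex.conj_mul']; push_cast; rfl
  rw [discDeriv_comp hf, moebius_zero, discDeriv_moebius, blochWeight, norm_mul]
  simp only [UnitDisc.coe_zero, mul_zero, add_zero, one_pow, div_one]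
  rw [e, Complex.norm_real, Real.norm_of_nonneg (one_sub_sq_pos z).le, mul_comm]

/-- Schwarz–Pick. The bound is independent of φ, so recentring at varying points keeps families
bounded. -/
theorem betaSeminorm_compositionOperator_le (φ : AnalyticSelfMap) (f : Bloch) :
    (compositionOperator φ f).betaSeminorm ≤ f.betaSeminorm := by
  refine ciSup_le fun z => ?_
  change blochWeight ((f : 𝔻 → ℂ) ∘ φ.toFun) z ≤ _
  rw [blochWeight, discDeriv_comp f.analytic, norm_mul]
  calc _ = ((1 - ‖(z : ℂ)‖ ^ 2) * ‖discDeriv (fun w => (φ.toFun w : ℂ)) z‖) *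
        ‖discDeriv f (φ.toFun z)‖ := by ring
    _ ≤ blochWeight f (φ.toFun z) :=
        mul_le_mul_of_nonneg_right (schwarzPick φ z) (norm_nonneg _)
    _ ≤ f.betaSeminorm := f.blochWeight_le _

namespace Bloch

theorem ext {f g : Bloch} (h : ∀ w, f w = g w) : f = g := Subtype.ext (funext h)

/-- Evaluation at a point of the disc, as a linear functional. -/
def eval (w : 𝔻) : Bloch →ₗ[ℂ] ℂ where
  toFun f := f w
  map_add' _ _ := rfl
  map_smul' _ _ := rfl

theorem eval_apply (w : 𝔻) (f : Bloch) : eval w f = f w := rfl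

theorem discExtend_eventuallyEq {f : 𝔻 → ℂ} {F : ℂ → ℂ} (h : ∀ w : 𝔻, f w = F w) (z : 𝔻) :
    discExtend f =ᶠ[𝓝 (z : ℂ)] F := by
  filter_upwards [isOpen_ball.mem_nhds (coe_mem_ball z)] with u hu
  have := h (UnitDisc.mk u (by simpa using hu))
  rwa [← discExtend_coe f] at this

/-- The restriction of a polynomial to the disc. -/
def ofPolynomial (p : Polynomial ℂ) : Bloch :=
  ⟨fun w => p.eval (w : ℂ), by
    have h : ∀ z : 𝔻, discExtend (fun w => p.eval (w : ℂ)) =ᶠ[𝓝 (z : ℂ)] fun u => p.eval u :=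
      discExtend_eventuallyEq fun _ => rfl
    refine ⟨fun z hz => ?_, ?_⟩
    · exact ((h (UnitDisc.mk z (by simpa using hz))).differentiableAt_iff.2
        p.differentiableAt).differentiableWithinAt
    · obtain ⟨A, hA⟩ := (isCompact_closedBall (0 : ℂ) 1).exists_bound_of_continuousOn
        p.derivative.continuous.continuousOn
      refine ⟨A, ?_⟩
      rintro _ ⟨z, rfl⟩
      have hz := hA z (by simpa using z.norm_lt_one.le)
      rw [blochWeight, discDeriv, (h z).deriv_eq, p.deriv]
      refine (mul_le_of_le_one_left (norm_nonneg _) ?_).trans hz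
      have := sq_nonneg ‖(z : ℂ)‖
      linarith⟩

theorem ofPolynomial_apply (p : Polynomial ℂ) (w : 𝔻) : ofPolynomial p w = p.eval (w : ℂ) := rfl

theorem blochWeight_sub_ofPolynomial_C (f : Bloch) (a : ℂ) (z : 𝔻) :
    blochWeight (f - ofPolynomial (Polynomial.C a) : Bloch) z = blochWeight f z := by
  have h : discExtend (f - ofPolynomial (Polynomial.C a) : Bloch) =ᶠ[𝓝 (z : ℂ)]
      fun u => discExtend f u - a :=
    discExtend_eventuallyEq (fun w => by
      rw [coe_sub, Pi.sub_apply, ofPolynomial_apply, Polynomial.eval_C, discExtend_coe]) z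
  rw [blochWeight, blochWeight, discDeriv, discDeriv, h.deriv_eq, deriv_sub_const_fun]

theorem tendsto_apply {X : Type*} {l : Filter X} {f : X → Bloch} {g : Bloch}
    (h : Tendsto f l (𝓝 g)) (w : 𝔻) : Tendsto (fun x => f x w) l (𝓝 (g w)) := by
  rw [tendsto_iff_norm_sub_tendsto_zero] at h ⊢
  refine squeeze_zero (fun _ => norm_nonneg _) (fun x => (f x - g).norm_apply_le w) ?_
  simpa only [mul_zero] using h.const_mul (1 + 1 / (1 - ‖(w : ℂ)‖ ^ 2))

end Bloch

/-- A compact operator maps bounded families with pointwise null images to norm null families. -/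
theorem tendsto_norm_zero_of_isCompactOperator {T : Bloch →ₗ[ℂ] Bloch} (hT : IsCompactOperator T)
    {X : Type*} (l : Ultrafilter X) {f : X → Bloch} {M : ℝ} (hM : ∀ x, ‖f x‖ ≤ M)
    (h0 : ∀ w : 𝔻, Tendsto (fun x => T (f x) w) l (𝓝 0)) :
    Tendsto (fun x => ‖T (f x)‖) l (𝓝 0) := by
  obtain ⟨K, hK, hTK⟩ := hT.image_closedBall_subset_compact M
  obtain ⟨g, -, hg⟩ := hK.ultrafilter_le_nhds (l.map fun x => T (f x)) (by
    rw [le_principal_iff, Ultrafilter.mem_coe, Ultrafilter.mem_map]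
    exact univ_mem' fun x => hTK ⟨f x, by simpa using hM x, rfl⟩)
  replace hg : Tendsto (fun x => T (f x)) l (𝓝 g) := hg
  have : g = 0 := Bloch.ext fun w => tendsto_nhds_unique (Bloch.tendsto_apply hg w) (h0 w)
  rw [this] at hg
  simpa using hg.norm

/-! ### Recentred self-maps and their limits -/

namespace AnalyticSelfMap

/-- The self-map `φ` read in coordinates centred at `z` in the source and at `b` in the target. -/
def recentre (φ : AnalyticSelfMap) (b z : 𝔻) : AnalyticSelfMap :=
  (moebius (-b)).comp (φ.comp (moebius z))

theorem recentre_apply (φ : AnalyticSelfMap) (b z w : 𝔻) : (φ.recentre b z).toFun w =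
    (moebius (-b)).toFun (φ.toFun ((moebius z).toFun w)) := rfl

/-- The extension of `φ` to a function on `ℂ`. -/
def extend (φ : AnalyticSelfMap) : ℂ → ℂ := discExtend fun w => (φ.toFun w : ℂ)

theorem norm_extend_le (φ : AnalyticSelfMap) (u : ℂ) : ‖φ.extend u‖ ≤ 1 := φ.norm_discExtend_le u

theorem extend_coe (φ : AnalyticSelfMap) (w : 𝔻) : φ.extend w = φ.toFun w := discExtend_coe _ w

theorem norm_extend_sub_le (φ : AnalyticSelfMap) (u v : ℂ) : ‖φ.extend u - φ.extend v‖ ≤ 2 := by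
  linarith [norm_sub_le (φ.extend u) (φ.extend v), φ.norm_extend_le u, φ.norm_extend_le v]

/-- Pointwise limits of analytic self-maps, together with the limits of the derivatives at `0`. -/
theorem exists_tendsto_extend {X : Type*} (l : Ultrafilter X) (φ : X → AnalyticSelfMap) :
    ∃ ψ : ℂ → ℂ, ∃ a : ℂ, (∀ u, Tendsto (fun x => (φ x).extend u) l (𝓝 (ψ u))) ∧
      Tendsto (fun x => deriv (φ x).extend 0) l (𝓝 a) ∧ HasDerivAt ψ a 0 := by
  choose ψ _ hψ using fun u => exists_tendsto_of_norm_le l fun x => (φ x).norm_extend_le u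
  obtain ⟨a, -, ha⟩ := exists_tendsto_of_norm_le l fun x =>
    norm_deriv_le_div_of_norm_sub_le one_pos (φ x).analytic fun u _ => (φ x).norm_extend_sub_le u 0
  exact ⟨ψ, a, hψ, ha, hasDerivAt_of_tendsto_of_norm_sub_le one_pos (fun x => (φ x).analytic)
    (fun x u _ => (φ x).norm_extend_sub_le u 0) (fun u _ => (hψ u).sub (hψ 0)) ha⟩

theorem moebius_neg_add (b w : 𝔻) : ((moebius (-b)).toFun w : ℂ) + b =
    w * (1 - ‖(b : ℂ)‖ ^ 2) / (1 - conj (b : ℂ) * w) := by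
  have h1 := one_add_conj_mul_ne_zero (-b) w
  rw [coe_moebius]
  simp only [UnitDisc.coe_neg, map_neg, neg_mul, ← sub_eq_add_neg] at h1 ⊢
  rw [← Complex.mul_conj', div_add' _ _ _ h1]
  congr 1
  ring

/-- The denominator in `moebius_neg_add` is at least 1 - |w|. As |b| → 1 this makes σ_{-b}(w)
asymptotic to -b for each fixed w. -/
theorem norm_moebius_neg_add_le (b w : 𝔻) : ‖((moebius (-b)).toFun w : ℂ) + b‖ ≤
    (1 - ‖(b : ℂ)‖ ^ 2) / (1 - ‖(w : ℂ)‖) := by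
  have hw : 0 < 1 - ‖(w : ℂ)‖ := sub_pos.2 w.norm_lt_one
  have hb := (one_sub_sq_pos b).le
  have e : (1 - (‖(b : ℂ)‖ : ℂ) ^ 2) = ((1 - ‖(b : ℂ)‖ ^ 2 : ℝ) : ℂ) := by push_cast; rfl
  have h : 1 - ‖(w : ℂ)‖ ≤ ‖1 - conj (b : ℂ) * w‖ := by
    have h1 := norm_sub_norm_le (1 : ℂ) (conj (b : ℂ) * w)
    rw [norm_one, norm_mul, RCLike.norm_conj] at h1
    nlinarith [b.norm_lt_one, norm_nonneg (w : ℂ)]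
  rw [moebius_neg_add, e, norm_div, norm_mul, Complex.norm_real, Real.norm_of_nonneg hb]
  exact div_le_div₀ hb (mul_le_of_le_one_left hb w.norm_lt_one.le) hw h

end AnalyticSelfMap

theorem sum_smul_compositionOperator_apply {ι : Type*} [Fintype ι] (φ : ι → AnalyticSelfMap)
    (c : ι → ℂ) (f : Bloch) (w : 𝔻) :
    (∑ i, c i • compositionOperator (φ i) : Bloch →ₗ[ℂ] Bloch) f w =
      ∑ i, c i * f ((φ i).toFun w) := by
  rw [← Bloch.eval_apply, LinearMap.sum_apply, map_sum]
  rfl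

/-! ### The linear relation forced by compactness -/

section Compact

variable {ι : Type*} [Fintype ι] {φ : ι → AnalyticSelfMap} {c : ι → ℂ} {X : Type*}
  {l : Ultrafilter X} {b z : X → 𝔻} {Ψ : ι → ℂ → ℂ}

/-- If a combination of composition operators is compact, then the recentred limits of its symbols
satisfy a linear relation. -/
theorem sum_mul_eval_sub_eval_eq_zero
    (hT : IsCompactOperator (∑ i, c i • compositionOperator (φ i) : Bloch →ₗ[ℂ] Bloch))
    (hb : Tendsto (fun x => ‖(b x : ℂ)‖) l (𝓝 1))
    (hΨ : ∀ i u, Tendsto (fun x => ((φ i).recentre (b x) (z x)).extend u) l (𝓝 (Ψ i u)))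
    (p : Polynomial ℂ) (ζ : 𝔻) :
    ∑ i, c i * (p.eval (Ψ i ζ) - p.eval (Ψ i 0)) = 0 := by
  set T : Bloch →ₗ[ℂ] Bloch := ∑ i, c i • compositionOperator (φ i) with hTdef
  -- Since σ_{-b}(0) = -b, subtracting p(-b) normalises the value at 0; it also makes the family
  -- pointwise null as |b| → 1.
  let f : X → Bloch := fun x => compositionOperator (moebius (-b x)) (Bloch.ofPolynomial p) -
    Bloch.ofPolynomial (Polynomial.C (p.eval (-b x : ℂ)))
  have hf : ∀ x w, f x w = p.eval ((moebius (-b x)).toFun w : ℂ) - p.eval (-b x : ℂ) := by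
    intro x w
    simp only [f, Bloch.coe_sub, Pi.sub_apply, compositionOperator_apply, Bloch.ofPolynomial_apply,
      Polynomial.eval_C]
  have hfM : ∀ x, ‖f x‖ ≤ (Bloch.ofPolynomial p).betaSeminorm := by
    intro x
    refine Bloch.norm_le_of_blochWeight_le fun w => ?_
    rw [hf, moebius_zero, UnitDisc.coe_neg, sub_self, norm_zero, zero_add,
      Bloch.blochWeight_sub_ofPolynomial_C]
    exact (Bloch.blochWeight_le _ w).trans (betaSeminorm_compositionOperator_le _ _)
  obtain ⟨β, -, hβ⟩ := exists_tendsto_of_norm_le l fun x => (b x).norm_lt_one.le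
  have hf0 : ∀ w, Tendsto (fun x => f x w) l (𝓝 0) := by
    intro w
    have h1 : Tendsto (fun x => ((moebius (-b x)).toFun w : ℂ) + b x) l (𝓝 0) := by
      refine squeeze_zero_norm (fun x => norm_moebius_neg_add_le (b x) w) ?_
      simpa using ((hb.pow 2).const_sub 1).div_const (1 - ‖(w : ℂ)‖)
    have h2 : Tendsto (fun x => ((moebius (-b x)).toFun w : ℂ)) l (𝓝 (-β)) := by
      simpa using h1.sub hβ
    simp only [hf]
    simpa using ((p.continuous.tendsto _).comp h2).sub ((p.continuous.tendsto _).comp hβ.neg)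
  have hT0 : ∀ w, Tendsto (fun x => T (f x) w) l (𝓝 0) := by
    intro w
    simp only [hTdef, sum_smul_compositionOperator_apply]
    simpa using tendsto_finsetSum Finset.univ
      fun i _ => (hf0 ((φ i).toFun w)).const_mul (c i)
  have hTn := tendsto_norm_zero_of_isCompactOperator hT l hfM hT0
  have h1 : Tendsto (fun x => T (f x) ((moebius (z x)).toFun ζ) -
      T (f x) ((moebius (z x)).toFun 0)) l (𝓝 0) := by
    -- Composing with σ_z does not increase the seminorm, so the bound depends on ζ but not on z.
    refine squeeze_zero_norm (a := fun x => ‖T (f x)‖ / (1 - ‖(ζ : ℂ)‖ ^ 2)) (fun x => ?_) ?_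
    · refine ((compositionOperator (moebius (z x)) (T (f x))).norm_apply_sub_apply_zero_le ζ).trans ?_
      exact div_le_div_of_nonneg_right ((betaSeminorm_compositionOperator_le _ _).trans
        (Bloch.betaSeminorm_le_norm _)) (one_sub_sq_pos ζ).le
    · simpa using hTn.div_const (1 - ‖(ζ : ℂ)‖ ^ 2)
  have h2 : Tendsto (fun x => ∑ i, c i * (p.eval (((φ i).recentre (b x) (z x)).extend ζ) -
      p.eval (((φ i).recentre (b x) (z x)).extend 0))) l
      (𝓝 (∑ i, c i * (p.eval (Ψ i ζ) - p.eval (Ψ i 0)))) :=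
    tendsto_finsetSum _ fun i _ => (((p.continuous.tendsto _).comp (hΨ i ζ)).sub
      ((p.continuous.tendsto _).comp (hΨ i 0))).const_mul (c i)
  refine tendsto_nhds_unique h2 (h1.congr fun x => ?_)
  simp only [hTdef, sum_smul_compositionOperator_apply, hf]
  rw [← Finset.sum_sub_distrib]
  refine Finset.sum_congr rfl fun i _ => ?_
  rw [← UnitDisc.coe_zero, extend_coe, extend_coe, recentre_apply, recentre_apply]
  ring

/-- If a combination of composition operators without vanishing proper subsums is compact, and one
recentred symbol does not degenerate, then all recentred symbols have the same limit near `0`, and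
the coefficients sum to zero. -/
theorem sum_eq_zero_and_eventually_tendsto
    (hT : IsCompactOperator (∑ i, c i • compositionOperator (φ i) : Bloch →ₗ[ℂ] Bloch))
    (hJ : ∀ J : Finset ι, J.Nonempty → J ≠ Finset.univ → ∑ i ∈ J, c i ≠ 0) (j : ι)
    (hb : Tendsto (fun x => ‖((φ j).toFun (z x) : ℂ)‖) l (𝓝 1))
    (hD : ¬ Tendsto (fun x => deriv ((φ j).recentre ((φ j).toFun (z x)) (z x)).extend 0) l (𝓝 0)) :
    ∑ i, c i = 0 ∧ ∃ ψ : ℂ → ℂ, ContinuousAt ψ 0 ∧ ψ 0 = 0 ∧ ∀ᶠ u in 𝓝 0, ∀ i,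
      Tendsto (fun x => ((φ i).recentre ((φ j).toFun (z x)) (z x)).extend u) l (𝓝 (ψ u)) := by
  classical
  choose Ψ a hΨ ha hd using fun i =>
    exists_tendsto_extend l fun x => (φ i).recentre ((φ j).toFun (z x)) (z x)
  have haj : a j ≠ 0 := by
    intro h
    exact hD (h ▸ ha j)
  have key : ∀ ζ : 𝔻, (∀ i, Ψ j ζ ≠ Ψ i 0) → ∑ i, c i = 0 ∧ ∀ i, Ψ i ζ = Ψ j ζ := by
    intro ζ hζ
    -- All limit values at ζ and at 0 except Ψ_j(ζ); p vanishes exactly on this set, so only the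
    -- indices with Ψ_i(ζ) = Ψ_j(ζ) contribute to the relation.
    let S : Finset ℂ := (Finset.univ.image (fun i => Ψ i ζ) ∪
      Finset.univ.image (fun i => Ψ i 0)).erase (Ψ j ζ)
    let p : Polynomial ℂ := ∏ s ∈ S, (Polynomial.X - Polynomial.C s)
    have hp0 : p.eval (Ψ j ζ) ≠ 0 := by
      simp only [p, Polynomial.eval_prod, Polynomial.eval_sub, Polynomial.eval_X,
        Polynomial.eval_C]
      refine Finset.prod_ne_zero_iff.2 fun s hs => sub_ne_zero.2 ?_
      exact (Finset.ne_of_mem_erase hs).symm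
    have hpS : ∀ s ∈ S, p.eval s = 0 := by
      intro s hs
      simp only [p, Polynomial.eval_prod, Polynomial.eval_sub, Polynomial.eval_X,
        Polynomial.eval_C]
      exact Finset.prod_eq_zero hs (sub_self s)
    have hp1 : ∀ i, p.eval (Ψ i 0) = 0 := fun i =>
      hpS _ (Finset.mem_erase.2 ⟨(hζ i).symm, by simp⟩)
    have hp2 : ∀ i, Ψ i ζ ≠ Ψ j ζ → p.eval (Ψ i ζ) = 0 := fun i hi =>
      hpS _ (Finset.mem_erase.2 ⟨hi, by simp⟩)
    have hs := sum_mul_eval_sub_eval_eq_zero hT hb hΨ p ζ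
    have hsum : (∑ i with Ψ i ζ = Ψ j ζ, c i) * p.eval (Ψ j ζ) = 0 := by
      rw [← hs, Finset.sum_mul, Finset.sum_filter]
      refine Finset.sum_congr rfl fun i _ => ?_
      split_ifs with h
      · rw [h, hp1, sub_zero]
      · rw [hp1, hp2 i h, sub_zero, mul_zero]
    have h0 := (mul_eq_zero.1 hsum).resolve_right hp0
    have hJu : Finset.univ.filter (fun i => Ψ i ζ = Ψ j ζ) = Finset.univ := by
      by_contra h
      exact hJ _ ⟨j, by simp⟩ h h0
    refine ⟨by rwa [hJu] at h0, fun i => ?_⟩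
    simpa using Finset.ext_iff.1 hJu i
  have hev : ∀ᶠ u in 𝓝[≠] (0 : ℂ), ∑ i, c i = 0 ∧ ∀ i, Ψ i u = Ψ j u := by
    have h1 : ∀ᶠ u in 𝓝[≠] (0 : ℂ), ∀ i, Ψ j u ≠ Ψ i 0 :=
      -- A nonzero derivative at 0 keeps Ψ_j away from any given value on a punctured neighbourhood.
      eventually_all.2 fun i => (hd j).eventually_ne haj
    have h2 : ∀ᶠ u in 𝓝[≠] (0 : ℂ), u ∈ ball (0 : ℂ) 1 :=
      mem_nhdsWithin_of_mem_nhds (ball_mem_nhds 0 one_pos)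
    filter_upwards [h1, h2] with u hu1 hu2
    exact key (UnitDisc.mk u (by simpa using hu2)) hu1
  -- The interpolation argument says nothing at ζ = 0, so equality there comes from continuity.
  have h0 : ∀ i, Ψ i 0 = Ψ j 0 := fun i =>
    tendsto_nhds_unique_of_eventuallyEq
      ((hd i).continuousAt.tendsto.mono_left nhdsWithin_le_nhds)
      ((hd j).continuousAt.tendsto.mono_left nhdsWithin_le_nhds) (hev.mono fun u hu => hu.2 i)
  refine ⟨hev.exists.choose_spec.1, Ψ j, (hd j).continuousAt, ?_, ?_⟩
  · refine tendsto_nhds_unique (hΨ j 0) (tendsto_const_nhds.congr fun x => ?_)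
    rw [← UnitDisc.coe_zero, extend_coe, recentre_apply, moebius_zero, moebius_neg_self]
  · rw [eventually_nhdsWithin_iff] at hev
    filter_upwards [hev] with u hu i
    rcases eq_or_ne u 0 with rfl | h
    · exact h0 i ▸ hΨ i 0
    · exact (hu h).2 i ▸ hΨ i u

end Compact

/-! ### Pointwise limits in the Bloch space -/

namespace Bloch

theorem betaSeminorm_sub_le (f g : Bloch) :
    (f - g).betaSeminorm ≤ f.betaSeminorm + g.betaSeminorm := by
  refine ciSup_le fun z => ?_
  have h := blochWeight_add f.analytic (((-1 : ℂ) • g).analytic) z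
  rw [← coe_add, neg_one_smul, ← sub_eq_add_neg, ← neg_one_smul ℂ g, coe_smul,
    blochWeight_smul _ g.analytic, norm_neg, norm_one, one_mul] at h
  exact h.trans (add_le_add (f.blochWeight_le z) (g.blochWeight_le z))

theorem blochWeight_sub_le (f g : Bloch) (z : 𝔻) :
    blochWeight (f - g : Bloch) z ≤ blochWeight f z + blochWeight g z := by
  have h := blochWeight_add f.analytic (((-1 : ℂ) • g).analytic) z
  rwa [← coe_add, neg_one_smul, ← sub_eq_add_neg, ← neg_one_smul ℂ g, coe_smul,
    blochWeight_smul _ g.analytic, norm_neg, norm_one, one_mul] at h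

/-- Bloch functions of bounded seminorm have uniformly bounded oscillation near each point. -/
theorem exists_ball_norm_sub_le (w : 𝔻) (M : ℝ) : ∃ r > 0, ∃ B, ball (w : ℂ) r ⊆ ball 0 1 ∧
    ∀ f : Bloch, f.betaSeminorm ≤ M → ∀ u ∈ ball (w : ℂ) r,
      ‖discExtend f u - discExtend f w‖ ≤ B := by
  have hw := w.norm_lt_one
  set R : ℝ := (1 + ‖(w : ℂ)‖) / 2 with hR
  have hsub : ∀ u ∈ ball (w : ℂ) ((1 - ‖(w : ℂ)‖) / 2), ‖u‖ ≤ R := by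
    intro u hu
    rw [mem_ball_iff_norm] at hu
    have := norm_le_norm_add_norm_sub' u (w : ℂ)
    linarith
  have hR1 : R < 1 := by linarith
  refine ⟨(1 - ‖(w : ℂ)‖) / 2, by linarith, M / (1 - R ^ 2) * 2, fun u hu => ?_,
    fun f hf u hu => ?_⟩
  · simpa using (hsub u hu).trans_lt hR1
  · refine (norm_sub_le_of_blochWeight_le f.analytic (fun z => (f.blochWeight_le z).trans hf) hR1
      (hsub u hu) (by linarith)).trans ?_
    have h0 : 0 ≤ R := (norm_nonneg u).trans (hsub u hu)
    have hM : 0 ≤ M := f.betaSeminorm_nonneg.trans hf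
    have h1 : 0 < 1 - R ^ 2 := by nlinarith
    have h2 : ‖u - w‖ ≤ 2 := by linarith [norm_sub_le u (w : ℂ), hsub u hu]
    gcongr

variable {X : Type*} {l : Ultrafilter X}

/-- Closed balls of the Bloch space are compact for pointwise convergence. -/
theorem exists_tendsto_pointwise (l : Ultrafilter X) {f : X → Bloch} {M : ℝ}
    (hM : ∀ x, ‖f x‖ ≤ M) :
    ∃ g : Bloch, ‖g‖ ≤ M ∧ ∀ w, Tendsto (fun x => f x w) l (𝓝 (g w)) := by
  have hb : ∀ w : 𝔻, ∃ a, ‖a‖ ≤ (1 + 1 / (1 - ‖(w : ℂ)‖ ^ 2)) * M ∧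
      Tendsto (fun x => f x w) l (𝓝 a) := by
    intro w
    refine exists_tendsto_of_norm_le l fun x => ((f x).norm_apply_le w).trans ?_
    have := one_sub_sq_pos w
    gcongr
    exact hM x
  choose G _ hG using hb
  have hGe : ∀ u, Tendsto (fun x => discExtend (f x) u) l (𝓝 (discExtend G u)) := by
    intro u
    by_cases hu : ‖u‖ < 1
    · simpa only [discExtend, hu, dif_pos] using hG (UnitDisc.mk u hu)
    · simp only [discExtend, hu, dif_neg, not_false_eq_true, tendsto_const_nhds]
  have hd : ∀ w : 𝔻, ∃ a, HasDerivAt (discExtend G) a w ∧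
      Tendsto (fun x => discDeriv (f x) w) l (𝓝 a) := by
    intro w
    obtain ⟨r, hr, B, hsub, hB⟩ := exists_ball_norm_sub_le w M
    have hF : ∀ x, DifferentiableOn ℂ (discExtend (f x)) (ball w r) :=
      fun x => DifferentiableOn.mono (f x).analytic hsub
    have hFB := fun x => hB (f x) ((f x).betaSeminorm_le_norm.trans (hM x))
    obtain ⟨a, -, ha⟩ := exists_tendsto_of_norm_le l
      fun x => norm_deriv_le_div_of_norm_sub_le hr (hF x) (hFB x)
    exact ⟨a, hasDerivAt_of_tendsto_of_norm_sub_le hr hF hFB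
      (fun u _ => (hGe u).sub (hGe w)) ha, ha⟩
  -- Derivatives converge along with values, so the norm bound passes to the limit pointwise in w.
  have hle : ∀ w, ‖G 0‖ + blochWeight G w ≤ M := by
    intro w
    obtain ⟨a, ha, hlim⟩ := hd w
    rw [blochWeight, discDeriv, ha.deriv]
    refine le_of_tendsto ((hG 0).norm.add (hlim.norm.const_mul (1 - ‖(w : ℂ)‖ ^ 2)))
      (Eventually.of_forall fun x => ?_)
    exact (add_le_add le_rfl ((f x).blochWeight_le w)).trans (hM x)
  refine ⟨⟨G, fun w hw => ?_, M, ?_⟩, norm_le_of_blochWeight_le hle, hG⟩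
  · obtain ⟨a, ha, -⟩ := hd (UnitDisc.mk w (by simpa using hw))
    exact ha.differentiableAt.differentiableWithinAt
  · rintro _ ⟨w, rfl⟩
    linarith [hle w, norm_nonneg (G 0)]

theorem tendsto_sub_zero_of_tendsto {f : X → Bloch} {M : ℝ} (hM : ∀ x, (f x).betaSeminorm ≤ M)
    {q q' : X → ℂ} {p : ℂ} (hp : ‖p‖ < 1) (hq : Tendsto q l (𝓝 p)) (hq' : Tendsto q' l (𝓝 p)) :
    Tendsto (fun x => discExtend (f x) (q x) - discExtend (f x) (q' x)) l (𝓝 0) := by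
  obtain ⟨R, hpR, hR⟩ := exists_between hp
  refine squeeze_zero_norm' (a := fun x => M / (1 - R ^ 2) * ‖q x - q' x‖) ?_ ?_
  · filter_upwards [hq.norm.eventually_lt_const hpR, hq'.norm.eventually_lt_const hpR] with x h h'
    exact norm_sub_le_of_blochWeight_le (f x).analytic
      (fun z => ((f x).blochWeight_le z).trans (hM x)) hR h.le h'.le
  · simpa using (hq.sub hq').norm.const_mul (M / (1 - R ^ 2))

/-- The weight at 0 is |f'(0)|, and bounded oscillation near 0 turns pointwise convergence to 0 into
convergence of derivatives. -/
theorem tendsto_blochWeight_zero {f : X → Bloch} {M : ℝ} (hM : ∀ x, (f x).betaSeminorm ≤ M)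
    (h0 : ∀ᶠ u in 𝓝 (0 : ℂ), Tendsto (fun x => discExtend (f x) u) l (𝓝 0)) :
    Tendsto (fun x => blochWeight (f x) 0) l (𝓝 0) := by
  obtain ⟨r, hr, B, hsub, hB⟩ := exists_ball_norm_sub_le 0 M
  rw [UnitDisc.coe_zero] at hsub hB
  obtain ⟨s, hs, hs0⟩ := Metric.eventually_nhds_iff_ball.1 h0
  have hrs : 0 < min r s := lt_min hr hs
  have h := tendsto_deriv_zero_of_tendsto_sub_zero (l := l) hrs
    (fun x => DifferentiableOn.mono (f x).analytic
      ((ball_subset_ball (min_le_left r s)).trans hsub))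
    (fun x u hu => hB (f x) (hM x) u (ball_subset_ball (min_le_left r s) hu))
    (fun u hu => by
      simpa using (hs0 u (ball_subset_ball (min_le_right r s) hu)).sub (hs0 0 (mem_ball_self hs)))
  simpa [blochWeight, discDeriv] using h.norm

end Bloch

theorem blochWeight_eq_blochWeight_compositionOperator_moebius (f : Bloch) (z : 𝔻) :
    blochWeight f z = blochWeight (compositionOperator (moebius z) f) 0 := by
  rw [blochWeight_eq_norm_discDeriv_comp_moebius f.analytic, blochWeight]
  simp only [UnitDisc.coe_zero, norm_zero, ne_eq, OfNat.ofNat_ne_zero, not_false_eq_true, zero_pow,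
    sub_zero, one_mul]
  rfl

theorem compositionOperator_comp (φ ψ : AnalyticSelfMap) (f : Bloch) :
    compositionOperator (φ.comp ψ) f = compositionOperator ψ (compositionOperator φ f) := rfl

/-- The inner σ_b ∘ σ_{-b} cancels. This moves the base points to the origin without losing control
of the seminorm. -/
theorem compositionOperator_recentre (φ : AnalyticSelfMap) (b z : 𝔻) (f : Bloch) :
    compositionOperator (φ.recentre b z) (compositionOperator (moebius b) f) =
      compositionOperator (moebius z) (compositionOperator φ f) := by
  refine Bloch.ext fun w => ?_
  simp only [compositionOperator_apply, recentre_apply, moebius_moebius_neg]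

/-! ### Images of pointwise null families -/

section Null

variable {X : Type*} {l : Ultrafilter X} {h : X → Bloch} {M : ℝ} {z : X → 𝔻}

/-- The images of a bounded pointwise null family under `C_φ` have small weighted derivative along
families of points at which `φ` stays away from the circle or degenerates. -/
theorem tendsto_blochWeight_compositionOperator (hM : ∀ x, ‖h x‖ ≤ M)
    (h0 : ∀ w, Tendsto (fun x => h x w) l (𝓝 0)) (φ : AnalyticSelfMap)
    (hφ : Tendsto (fun x => ‖(φ.toFun (z x) : ℂ)‖) l (𝓝 1) →
      Tendsto (fun x => deriv (φ.recentre (φ.toFun (z x)) (z x)).extend 0) l (𝓝 0)) :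
    Tendsto (fun x => blochWeight (compositionOperator φ (h x)) (z x)) l (𝓝 0) := by
  have hβ : ∀ x, (h x).betaSeminorm ≤ M := fun x => (h x).betaSeminorm_le_norm.trans (hM x)
  obtain ⟨ψ, a, hψ, -, hd⟩ := exists_tendsto_extend l fun x => φ.comp (moebius (z x))
  have hψ0 : Tendsto (fun x => (φ.toFun (z x) : ℂ)) l (𝓝 (ψ 0)) := by
    refine (hψ 0).congr fun x => ?_
    rw [← UnitDisc.coe_zero, extend_coe, comp_apply, moebius_zero]
  -- Either φ(z) stays inside the disc in the limit, and equicontinuity transfers the nullity of h,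
  -- or |φ(z)| → 1, and the weight is at most M times the derivative of the recentred map at 0.
  rcases (le_of_tendsto hψ0.norm (Eventually.of_forall fun x =>
    (φ.toFun (z x)).norm_lt_one.le)).lt_or_eq with hlt | heq
  · have h1 : ∀ᶠ u in 𝓝 (0 : ℂ), ‖ψ u‖ < 1 := hd.continuousAt.norm.eventually_lt_const hlt
    simp_rw +singlePass [blochWeight_eq_blochWeight_compositionOperator_moebius]
    simp only [← compositionOperator_comp]
    refine Bloch.tendsto_blochWeight_zero
      (fun x => (betaSeminorm_compositionOperator_le _ _).trans (hβ x)) ?_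
    filter_upwards [h1, ball_mem_nhds (0 : ℂ) one_pos] with u hu hu1
    have h2 := Bloch.tendsto_sub_zero_of_tendsto hβ hu (hψ u) tendsto_const_nhds
    have h3 : Tendsto (fun x => discExtend (h x) (ψ u)) l (𝓝 0) :=
      (h0 (UnitDisc.mk (ψ u) hu)).congr fun x => (discExtend_coe (h x) (UnitDisc.mk (ψ u) hu)).symm
    have h4 := h2.add h3
    simp only [sub_add_cancel, add_zero] at h4
    exact h4.congr fun x => (discExtend_comp (h x) (φ.comp (moebius (z x))) hu1).symm
  · have hD := hφ (heq ▸ hψ0.norm)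
    refine squeeze_zero (fun x => blochWeight_nonneg _ _) (fun x => ?_)
      (by simpa using hD.norm.const_mul M)
    rw [blochWeight_eq_blochWeight_compositionOperator_moebius,
      ← compositionOperator_recentre _ (φ.toFun (z x))]
    set H := compositionOperator (moebius (φ.toFun (z x))) (h x)
    set R := φ.recentre (φ.toFun (z x)) (z x) with hR
    have e : discDeriv (compositionOperator R H) 0 = discDeriv H 0 * deriv R.extend 0 := by
      refine (discDeriv_comp H.analytic R 0).trans ?_
      have : R.toFun 0 = 0 := by rw [hR, recentre_apply, moebius_zero, moebius_neg_self]
      rw [this, discDeriv, discDeriv, UnitDisc.coe_zero]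
      rfl
    have hH : blochWeight H 0 ≤ M :=
      (H.blochWeight_le 0).trans ((betaSeminorm_compositionOperator_le _ _).trans (hβ x))
    rw [blochWeight, UnitDisc.coe_zero, norm_zero] at hH ⊢
    rw [e, norm_mul, ← mul_assoc]
    gcongr

/-- The images of a bounded pointwise null family under `C_φ - C_ψ` have small weighted derivative
along families of points at which the recentred maps have the same limit. -/
theorem tendsto_blochWeight_compositionOperator_sub (hM : ∀ x, ‖h x‖ ≤ M) {φ ψ : AnalyticSelfMap}
    {b : X → 𝔻} {Ψ : ℂ → ℂ} (hΨ : ∀ᶠ u in 𝓝 (0 : ℂ), ‖Ψ u‖ < 1)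
    (hφ : ∀ᶠ u in 𝓝 0, Tendsto (fun x => (φ.recentre (b x) (z x)).extend u) l (𝓝 (Ψ u)))
    (hψ : ∀ᶠ u in 𝓝 0, Tendsto (fun x => (ψ.recentre (b x) (z x)).extend u) l (𝓝 (Ψ u))) :
    Tendsto (fun x => blochWeight
      ((compositionOperator φ - compositionOperator ψ : Bloch →ₗ[ℂ] Bloch) (h x)) (z x))
      l (𝓝 0) := by
  have hβ : ∀ x (χ : AnalyticSelfMap), (compositionOperator χ (h x)).betaSeminorm ≤ M :=
    fun x χ => (betaSeminorm_compositionOperator_le _ _).trans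
      ((h x).betaSeminorm_le_norm.trans (hM x))
  simp_rw +singlePass [blochWeight_eq_blochWeight_compositionOperator_moebius]
  simp only [LinearMap.sub_apply]
  refine Bloch.tendsto_blochWeight_zero (M := M + M)
    (fun x => (betaSeminorm_compositionOperator_le _ _).trans
      ((Bloch.betaSeminorm_sub_le _ _).trans (add_le_add (hβ x φ) (hβ x ψ)))) ?_
  filter_upwards [hΨ, hφ, hψ, ball_mem_nhds (0 : ℂ) one_pos] with u hu h1 h2 hu1
  refine (Bloch.tendsto_sub_zero_of_tendsto (fun x => hβ x (moebius (b x))) hu h1 h2).congr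
    fun x => ?_
  rw [map_sub, ← compositionOperator_recentre φ (b x), ← compositionOperator_recentre ψ (b x),
    AnalyticSelfMap.extend, AnalyticSelfMap.extend, ← discExtend_comp _ _ hu1, ← discExtend_comp _ _ hu1]
  obtain ⟨v, rfl⟩ : ∃ v : 𝔻, (v : ℂ) = u := ⟨UnitDisc.mk u (by simpa using hu1), rfl⟩
  simp only [discExtend_coe]
  rfl

end Null

/-! ### Compactness criterion and the main equivalence -/

/-- An operator on the Bloch space is compact if it maps bounded pointwise null families to families
that are null at `0` and whose weighted derivatives are uniformly null. -/
theorem isCompactOperator_of_forall_tendsto {T : Bloch →ₗ[ℂ] Bloch}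
    (hT : ∀ (l : Ultrafilter Bloch) (h : Bloch → Bloch) (M : ℝ) (z : Bloch → 𝔻),
      (∀ x, ‖h x‖ ≤ M) → (∀ w, Tendsto (fun x => h x w) l (𝓝 0)) →
      Tendsto (fun x => T (h x) 0) l (𝓝 0) ∧
      Tendsto (fun x => blochWeight (T (h x)) (z x)) l (𝓝 0)) :
    IsCompactOperator T := by
  classical
  rw [isCompactOperator_iff_isCompact_closure_image_closedBall T one_pos]
  -- The image of the closed ball is itself compact, because the ball is compact for pointwise
  -- convergence.
  refine IsCompact.closure (isCompact_iff_ultrafilter_le_nhds.2 fun l hl => ?_)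
  -- Preimages chosen on all of `Bloch`, so that l can index them; the value 0 off the image keeps
  -- the family bounded.
  have hs : ∀ y, ∃ x : Bloch, ‖x‖ ≤ 1 ∧ (y ∈ T '' closedBall 0 1 → T x = y) := by
    intro y
    by_cases hy : y ∈ T '' closedBall 0 1
    · obtain ⟨x, hx, rfl⟩ := hy
      exact ⟨x, by simpa using hx, fun _ => rfl⟩
    · exact ⟨0, by simp, fun h => absurd h hy⟩
  choose s hs1 hsT using hs
  obtain ⟨g, hg1, hg⟩ := Bloch.exists_tendsto_pointwise l hs1
  refine ⟨T g, ⟨g, by simpa using hg1, rfl⟩, ?_⟩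
  let h : Bloch → Bloch := fun y => s y - g
  have hM : ∀ y, ‖h y‖ ≤ 1 + 1 := fun y => (norm_sub_le _ _).trans (add_le_add (hs1 y) hg1)
  have h0 : ∀ w, Tendsto (fun y => h y w) l (𝓝 0) := by
    intro w
    simpa [h, Bloch.coe_sub] using (hg w).sub_const (g w)
  have key : ∀ ε > 0, ∀ᶠ y in (l : Filter Bloch), (T (h y)).betaSeminorm ≤ ε := by
    intro ε hε
    by_contra hcon
    -- For an ultrafilter, failing to hold eventually means failing eventually, so one family of bad
    -- points z contradicts the hypothesis along l.
    rw [← Ultrafilter.eventually_not] at hcon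
    have hz : ∀ y, ∃ z, ¬ (T (h y)).betaSeminorm ≤ ε → ε < blochWeight (T (h y)) z := by
      intro y
      by_cases hy : (T (h y)).betaSeminorm ≤ ε
      · exact ⟨0, fun h => absurd hy h⟩
      · obtain ⟨z, hz⟩ := exists_lt_of_lt_ciSup (not_le.1 hy)
        exact ⟨z, fun _ => hz⟩
    choose z hz using hz
    obtain ⟨y, hy1, hy2⟩ := (hcon.and
      ((hT l h _ z hM h0).2.eventually_lt_const hε)).exists
    exact (hz y hy1).not_gt hy2
  have hlim : Tendsto (fun y => T (s y)) l (𝓝 (T g)) := by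
    rw [Metric.tendsto_nhds]
    intro ε hε
    have h1 := (hT l h _ (fun _ => 0) hM h0).1.norm
    rw [norm_zero] at h1
    filter_upwards [key (ε / 2) (half_pos hε), h1.eventually_lt_const (half_pos hε)] with y hy1 hy2
    rw [dist_eq_norm, ← map_sub]
    change ‖T (h y) 0‖ + (T (h y)).betaSeminorm < ε
    linarith
  refine (tendsto_id'.1 (hlim.congr' ?_))
  filter_upwards [le_principal_iff.1 hl] with y hy using hsT y hy

/-- A noncompact composition operator has a nondegenerate symbol along some family of points. -/
theorem exists_tendsto_of_not_isCompactOperator {φ : AnalyticSelfMap}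
    (hφ : ¬ IsCompactOperator (compositionOperator φ)) :
    ∃ (l : Ultrafilter Bloch) (z : Bloch → 𝔻),
      Tendsto (fun x => ‖(φ.toFun (z x) : ℂ)‖) l (𝓝 1) ∧
      ¬ Tendsto (fun x => deriv (φ.recentre (φ.toFun (z x)) (z x)).extend 0) l (𝓝 0) := by
  by_contra! hcon
  exact hφ (isCompactOperator_of_forall_tendsto fun l h M z hM h0 => ⟨h0 _,
    tendsto_blochWeight_compositionOperator hM h0 φ (hcon l z)⟩)

/-- Along a given ultrafilter, either some symbol, not necessarily the i-th or j-th, is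
nondegenerate and forces a common recentred limit, or both images are null separately. -/
theorem isCompactOperator_sub_of_isCompactOperator_sum {ι : Type*} [Fintype ι]
    {φ : ι → AnalyticSelfMap} {c : ι → ℂ}
    (hT : IsCompactOperator (∑ i, c i • compositionOperator (φ i) : Bloch →ₗ[ℂ] Bloch))
    (hJ : ∀ J : Finset ι, J.Nonempty → J ≠ Finset.univ → ∑ i ∈ J, c i ≠ 0) (i j : ι) :
    IsCompactOperator
      (compositionOperator (φ i) - compositionOperator (φ j) : Bloch →ₗ[ℂ] Bloch) := by
  refine isCompactOperator_of_forall_tendsto fun l h M z hM h0 => ⟨?_, ?_⟩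
  · simpa [Bloch.coe_sub, compositionOperator_apply] using
      (h0 ((φ i).toFun 0)).sub (h0 ((φ j).toFun 0))
  · by_cases hex : ∃ m, Tendsto (fun x => ‖((φ m).toFun (z x) : ℂ)‖) l (𝓝 1) ∧
      ¬ Tendsto (fun x => deriv ((φ m).recentre ((φ m).toFun (z x)) (z x)).extend 0) l (𝓝 0)
    · obtain ⟨m, hb, hD⟩ := hex
      obtain ⟨-, ψ, hψc, hψ0, hψ⟩ := sum_eq_zero_and_eventually_tendsto hT hJ m hb hD
      have h1 : ∀ᶠ u in 𝓝 (0 : ℂ), ‖ψ u‖ < 1 :=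
        hψc.norm.eventually_lt_const (by simp [hψ0])
      exact tendsto_blochWeight_compositionOperator_sub hM h1 (hψ.mono fun u hu => hu i)
        (hψ.mono fun u hu => hu j)
    · push Not at hex
      refine squeeze_zero (fun x => blochWeight_nonneg _ _)
        (fun x => Bloch.blochWeight_sub_le _ _ _) ?_
      simpa using (tendsto_blochWeight_compositionOperator hM h0 (φ i) (hex i)).add
        (tendsto_blochWeight_compositionOperator hM h0 (φ j) (hex j))

theorem isCompactOperator_sum_smul {ι : Type*} (s : Finset ι) (c : ι → ℂ)
    {S : ι → Bloch →ₗ[ℂ] Bloch} (hS : ∀ i, IsCompactOperator (S i)) :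
    IsCompactOperator (∑ i ∈ s, c i • S i : Bloch →ₗ[ℂ] Bloch) := by
  classical
  induction s using Finset.induction_on with
  | empty => exact isCompactOperator_zero (M₁ := Bloch) (M₂ := Bloch)
  | insert i s hi ih =>
    rw [Finset.sum_insert hi]
    exact ((hS i).smul (c i)).add ih

end

theorem theorem3 (k : ℕ) (hk : 0 < k) (φ : Fin k → AnalyticSelfMap) (c : Fin k → ℂ)
    (hc : ∀ i, c i ≠ 0)
    (hJ : ∀ J : Finset (Fin k), J.Nonempty → J ≠ Finset.univ → ∑ i ∈ J, c i ≠ 0)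
    (hnc : ∃ i, ¬ IsCompactOperator (compositionOperator (φ i))) :
    IsCompactOperator (∑ i, c i • compositionOperator (φ i) : Bloch →ₗ[ℂ] Bloch) ↔
      (∑ i, c i = 0) ∧
      ∀ i j, IsCompactOperator
        (compositionOperator (φ i) - compositionOperator (φ j) : Bloch →ₗ[ℂ] Bloch) := by
  obtain ⟨i₀, hi₀⟩ := hnc
  refine ⟨fun hT => ⟨?_, isCompactOperator_sub_of_isCompactOperator_sum hT hJ⟩, ?_⟩
  · obtain ⟨l, z, hb, hD⟩ := exists_tendsto_of_not_isCompactOperator hi₀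
    exact (sum_eq_zero_and_eventually_tendsto hT hJ i₀ hb hD).1
  · rintro ⟨hsum, hcomp⟩
    -- Subtracting (∑ c_i) C_{φ_{i₀}} = 0; any index would serve as i₀ here.
    have e : (∑ i, c i • compositionOperator (φ i) : Bloch →ₗ[ℂ] Bloch) =
        ∑ i, c i • (compositionOperator (φ i) - compositionOperator (φ i₀)) := by
      simp only [smul_sub, Finset.sum_sub_distrib, ← Finset.sum_smul, hsum, zero_smul, sub_zero]
    rw [e]
    exact isCompactOperator_sum_smul Finset.univ c fun i => hcomp i i₀
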